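/- Let $G$ be a finite simple graph with vertex set $V$ (the sites), let $N\ge 2$ be an integer, and let $J_{xy}=J_{yx}$ and $J'_{xy}=J'_{yx}$ be real couplings attached to the edges $\langle xy\rangle$ of $G$, with $|J'_{xy}|\le J_{xy}$ for every edge. Consider the $N$-vector model with spins $\boldsymbol\sigma_x\in S^{N-1}\subset\mathbb R^N$ and Boltzmann–Gibbs measure $Z^{-1}e^{-H'}\prod_x d\Omega(\boldsymbol\sigma_x)$, where $H'=-\sum_{\langle xy\rangle}J'_{xy}\,\boldsymbol\sigma_x\cdot\boldsymbol\sigma_y$ and $d\Omega$ is the normalized uniform measure on $S^{N-1}$; write $\langle\,\cdot\,\rangle_{N,J'}$ for its expectation. Consider also the $XY$ model with angles $\theta_x\in[0,2\pi)$ and Boltzmann–Gibbs measure $Z^{-1}e^{-H}\prod_x d\theta_x$, where $H=-\sum_{\langle xy\rangle}J_{xy}\cos(\theta_x-\theta_y)$; write $\langle\,\cdot\,\rangle_{XY,J}$ for its expectation. Then for all sites $x,y\in V$ (adjacent or not, distinct or not) $$\left|\langle\boldsymbol\sigma_x\cdot\boldsymbol\sigma_y\rangle_{N,J'}\right|\;\le\;\langle\cos(\theta_x-\theta_y)\rangle_{XY,J},$$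 and, with $\gamma=\langle\cos 2(\theta_x-\theta_y)\rangle_{XY,J}$, $$0\;\le\;\langle(\boldsymbol\sigma_x\cdot\boldsymbol\sigma_y)^2\rangle_{N,J'}\;\le\;\frac1N+\frac{(N-1)(N+2)}{N\,[\,2N-(N-2)\gamma\,]}\,\gamma\;\le\;\frac1N+\Bigl(1-\frac1N\Bigr)\gamma .$$ -/

import Mathlib

open MeasureTheory

noncomputable section

/-- The unit sphere `S^{N-1}` in `ℝ^N`, the space of values of a single `N`-vector spin. -/
abbrev SpinSphere (N : ℕ) : Type :=
  Metric.sphere (0 : EuclideanSpace ℝ (Fin N)) 1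

/-- The scalar product `σ · τ` of two spins, taken in `ℝ^N`. -/
def spinDot {N : ℕ} (s t : SpinSphere N) : ℝ :=
  inner ℝ (s : EuclideanSpace ℝ (Fin N)) (t : EuclideanSpace ℝ (Fin N))

/-- The scalar product is symmetric, so that it is a function of the unordered pair of sites. -/
theorem spinDot_comm {N : ℕ} (s t : SpinSphere N) : spinDot s t = spinDot t s :=
  real_inner_comm _ _

/-- The function `cos (θ_x - θ_y)` is symmetric in the two sites. -/
theorem cos_sub_comm (a b : ℝ) : Real.cos (a - b) = Real.cos (b - a) := by
  rw [← Real.cos_neg, neg_sub]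

/-- The Hamiltonian `-∑_{⟨xy⟩} J_{xy} σ_x · σ_y` of the `N`-vector model on a graph. -/
def nVectorHamiltonian {V : Type*} (G : SimpleGraph V) [Fintype G.edgeSet] {N : ℕ}
    (J : Sym2 V → ℝ) (σ : V → SpinSphere N) : ℝ :=
  -∑ e ∈ G.edgeFinset,
    J e * Sym2.lift ⟨fun x y => spinDot (σ x) (σ y), fun x y => spinDot_comm (σ x) (σ y)⟩ e

/-- The Hamiltonian `-∑_{⟨xy⟩} J_{xy} cos (θ_x - θ_y)` of the `XY` model on a graph. -/
def xyHamiltonian {V : Type*} (G : SimpleGraph V) [Fintype G.edgeSet]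
    (J : Sym2 V → ℝ) (θ : V → ℝ) : ℝ :=
  -∑ e ∈ G.edgeFinset,
    J e * Sym2.lift ⟨fun x y => Real.cos (θ x - θ y), fun x y => cos_sub_comm (θ x) (θ y)⟩ e

/-- The normalized uniform measure `dΩ` on `S^{N-1}`: surface measure divided by its total mass. -/
def sphereUniform (N : ℕ) : Measure (SpinSphere N) :=
  ((volume : Measure (EuclideanSpace ℝ (Fin N))).toSphere Set.univ)⁻¹ •
    (volume : Measure (EuclideanSpace ℝ (Fin N))).toSphere

/-- The a priori measure `∏_x dΩ(σ_x)`. -/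
def nVectorPrior (V : Type*) [Fintype V] (N : ℕ) : Measure (V → SpinSphere N) :=
  Measure.pi fun _ => sphereUniform N

/-- The a priori measure `∏_x dθ_x`, each angle running over `[0, 2π)`. -/
def xyPrior (V : Type*) [Fintype V] : Measure (V → ℝ) :=
  Measure.pi fun _ => volume.restrict (Set.Ico 0 (2 * Real.pi))

/-- The Boltzmann-Gibbs measure `Z⁻¹ e^{-H} dμ`, with `Z = ∫ e^{-H} dμ`. -/
def gibbsMeasure {Ω : Type*} [MeasurableSpace Ω] (μ : Measure Ω) (H : Ω → ℝ) : Measure Ω :=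
  μ.tilted fun ω => -H ω

/-- The expectation `⟨f⟩` in the `N`-vector model with couplings `J` on the graph `G`. -/
def nVectorExpect {V : Type*} [Fintype V] (G : SimpleGraph V) [Fintype G.edgeSet] (N : ℕ)
    (J : Sym2 V → ℝ) (f : (V → SpinSphere N) → ℝ) : ℝ :=
  ∫ σ, f σ ∂(gibbsMeasure (nVectorPrior V N) (nVectorHamiltonian G J))

/-- The expectation `⟨f⟩` in the `XY` model with couplings `J` on the graph `G`. -/
def xyExpect {V : Type*} [Fintype V] (G : SimpleGraph V) [Fintype G.edgeSet]
    (J : Sym2 V → ℝ) (f : (V → ℝ) → ℝ) : ℝ :=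
  ∫ θ, f θ ∂(gibbsMeasure (xyPrior V) (xyHamiltonian G J))

end

/-! Rotate every spin by its own angle `φ x` in a fixed coordinate plane `(i, j)`. The a priori
measure is invariant under these rotations, so averages may be taken over `φ` first. With the spins
otherwise frozen, the weight in `φ` is, up to a constant factor, that of an `XY` model with
couplings `J' r_x r_y`, where `r ≤ 1` is the length of the projection to the plane; these are
bounded by `J` in absolute value. Ginibre's inequality on the torus (`ginibre_comparison`) then
bounds the average of `r_x^k r_y^k cos k(τ_x - τ_y)` by the average of `r_x^k r_y^k` times the `XY`
correlation of `cos k(θ_x - θ_y)` (`abs_nVectorExpect_le`).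

It remains to sum over all coordinate planes. For `k = 1` the planar products add up to a multiple
of `σ_x · σ_y`, and `r_x r_y ≤ (r_x² + r_y²) / 2` has a constant sum. For `k = 2` both sides are
affine in `Q = ⟨(σ_x · σ_y)²⟩` and `D = ⟨∑ σ_{x,i}² σ_{y,i}²⟩`. Global rotation invariance gives `(N
+ 2) D = 1 + 2 Q` (`nVectorExpect_squareOverlap`), and eliminating `D` leaves the stated bound on
`Q`. -/

/-! ### Ginibre's inequality on a compact 2-divisible abelian group. -/

section Ginibre

variable {K : Type*} [TopologicalSpace K]

/-- The cone spanned by the tensor squares `(α, β) ↦ F α * F β`, closed under products and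
uniform limits. -/
def tensorSquareCone (K : Type*) [TopologicalSpace K] [CompactSpace K] :
    Subsemiring C(K × K, ℝ) :=
  (Submonoid.subsemiringClosure
    { carrier := {h | ∃ F : C(K, ℝ), ∀ p, h p = F p.1 * F p.2}
      mul_mem' := by
        rintro a b ⟨F, hF⟩ ⟨F', hF'⟩
        exact ⟨F * F', fun p => by simp [hF, hF']; ring⟩
      one_mem' := ⟨1, fun p => by simp⟩ }).topologicalClosure

variable [CompactSpace K]

theorem tensorSquare_mem_cone {h : C(K × K, ℝ)} (F : C(K, ℝ))
    (hF : ∀ p, h p = F p.1 * F p.2) : h ∈ tensorSquareCone K :=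
  Subsemiring.le_topologicalClosure _ (AddSubmonoid.subset_closure ⟨F, hF⟩)

theorem smul_mem_tensorSquareCone {c : ℝ} (hc : 0 ≤ c) {h : C(K × K, ℝ)}
    (hh : h ∈ tensorSquareCone K) : c • h ∈ tensorSquareCone K := by
  have h1 : (algebraMap ℝ C(K × K, ℝ) c) ∈ tensorSquareCone K :=
    tensorSquare_mem_cone (ContinuousMap.const K (Real.sqrt c)) fun p => by
      simp [Real.mul_self_sqrt hc]
  rw [Algebra.smul_def]
  exact mul_mem h1 hh

/-- The exponential series has non-negative coefficients and converges uniformly. -/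
theorem exp_mem_tensorSquareCone {h : C(K × K, ℝ)} (hh : h ∈ tensorSquareCone K) :
    NormedSpace.exp h ∈ tensorSquareCone K := by
  have hs := (NormedSpace.exp_series_hasSum_exp' (𝕂 := ℝ) h)
  refine (Subsemiring.isClosed_topologicalClosure _).mem_of_tendsto hs
    (Filter.Eventually.of_forall fun s => ?_)
  exact sum_mem fun n _ => smul_mem_tensorSquareCone (by positivity) (pow_mem hh n)

theorem ContinuousMap.exp_apply {X : Type*} [TopologicalSpace X] [CompactSpace X]
    (h : C(X, ℝ)) (x : X) : (NormedSpace.exp h) x = Real.exp (h x) := by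
  rw [Real.exp_eq_exp_ℝ]
  exact NormedSpace.map_exp (ContinuousMap.evalAlgHom ℝ ℝ x) (continuous_eval_const x) h

variable [AddCommGroup K] [IsTopologicalAddGroup K]

/-- The duplicate-variable substitution `(α, β) ↦ (α - β, α + β)`. -/
def subAddHom (K : Type*) [AddCommGroup K] : K × K →+ K × K where
  toFun p := (p.1 - p.2, p.1 + p.2)
  map_zero' := by simp
  map_add' p q := by ext <;> simp <;> abel

/-- The cosine of a character. -/
noncomputable def cosChar (χ : K →+ Real.Angle) (hχ : Continuous χ) : C(K, ℝ) :=
  ⟨fun θ => (χ θ).cos, Real.Angle.continuous_cos.comp hχ⟩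

/-- The pullback of functions on `K × K` under `(α, β) ↦ (α - β, α + β)`. -/
def subAddPullback (h : C(K × K, ℝ)) : C(K × K, ℝ) :=
  ⟨fun p => h (p.1 - p.2, p.1 + p.2), by fun_prop⟩

/-- `cos (a - b) + cos (a + b) = 2 cos a cos b` is a tensor square with `F = √2 cos χ`. -/
theorem cosChar_add_mem (χ : K →+ Real.Angle) (hχ : Continuous χ) :
    subAddPullback ((cosChar χ hχ).comp .fst + (cosChar χ hχ).comp .snd)
      ∈ tensorSquareCone K := by
  refine tensorSquare_mem_cone (Real.sqrt 2 • cosChar χ hχ) fun p => ?_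
  have h2 := Real.mul_self_sqrt (show (0 : ℝ) ≤ 2 by norm_num)
  simp [subAddPullback, cosChar, sub_eq_add_neg, Real.Angle.cos_add]
  linear_combination (-(χ p.1).cos * (χ p.2).cos) * h2

/-- `cos (a - b) - cos (a + b) = 2 sin a sin b` is a tensor square with `F = √2 sin χ`. -/
theorem cosChar_sub_mem (χ : K →+ Real.Angle) (hχ : Continuous χ) :
    subAddPullback ((cosChar χ hχ).comp .fst - (cosChar χ hχ).comp .snd)
      ∈ tensorSquareCone K := by
  refine tensorSquare_mem_cone (Real.sqrt 2 •
    ⟨fun θ => (χ θ).sin, Real.Angle.continuous_sin.comp hχ⟩) fun p => ?_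
  have h2 := Real.mul_self_sqrt (show (0 : ℝ) ≤ 2 by norm_num)
  simp [subAddPullback, cosChar, sub_eq_add_neg, Real.Angle.cos_add]
  linear_combination (-(χ p.1).sin * (χ p.2).sin) * h2

variable [MeasurableSpace K] [BorelSpace K] [SecondCountableTopology K]
  (μ : Measure K)

/-- A tensor square integrates to `(∫ F)²`, and the integral is continuous for uniform convergence.
-/
theorem integral_tensorSquareCone_nonneg [IsFiniteMeasure μ] {h : C(K × K, ℝ)}
    (hh : h ∈ tensorSquareCone K) : 0 ≤ ∫ p, h p ∂(μ.prod μ) := by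
  have hint : ∀ g : C(K × K, ℝ), Integrable g (μ.prod μ) := fun g =>
    g.continuous.integrable_of_hasCompactSupport (HasCompactSupport.of_compactSpace _)
  have hcont : Continuous fun g : C(K × K, ℝ) => ∫ p, g p ∂(μ.prod μ) := by
    have := (continuous_integral (μ := μ.prod μ) (G := ℝ)).comp
      (ContinuousMap.toLp (E := ℝ) 1 (μ.prod μ) ℝ).continuous
    refine this.congr fun g => ?_
    exact integral_congr_ae (ContinuousMap.coeFn_toLp (𝕜 := ℝ) (μ.prod μ) g)
  refine closure_minimal (s := _) ?_ (isClosed_Ici.preimage hcont) hh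
  intro g hg
  -- Tensor squares are stable under products, so the semiring they generate consists of their
  -- finite sums.
  change g ∈ AddSubmonoid.closure _ at hg
  induction hg using AddSubmonoid.closure_induction with
  | mem g hg =>
    obtain ⟨F, hF⟩ := hg
    simp only [Set.mem_preimage, Set.mem_Ici, hF]
    rw [integral_prod_mul (fun x => F x) (fun x => F x)]
    exact mul_self_nonneg _
  | zero => simp
  | add a b _ _ ha hb =>
    simp only [Set.mem_preimage, Set.mem_Ici, ContinuousMap.add_apply] at *
    rw [integral_add (hint a) (hint b)]
    exact add_nonneg ha hb

/-- A continuous surjective endomorphism of a compact group preserves Haar measure. Surjectivity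
amounts to halving: `(a, b)` comes from `(c, c - a)` with `2c = a + b`. -/
theorem measurePreserving_subAddHom [μ.IsAddHaarMeasure] [IsFiniteMeasure μ]
    (hdiv : ∀ a : K, ∃ b, b + b = a) :
    MeasurePreserving (subAddHom K) (μ.prod μ) (μ.prod μ) := by
  refine AddMonoidHom.measurePreserving (f := subAddHom K) ?_ ?_ rfl
  · change Continuous fun p : K × K => (p.1 - p.2, p.1 + p.2)
    fun_prop
  · rintro ⟨a, b⟩
    obtain ⟨c, hc⟩ := hdiv (a + b)
    refine ⟨(c, c - a), ?_⟩
    simp only [subAddHom, AddMonoidHom.coe_mk, ZeroHom.coe_mk, Prod.mk.injEq]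
    exact ⟨by abel, by rw [← add_sub_assoc, hc]; abel⟩

/-- Ginibre's inequality for a duplicated system whose two copies have couplings `J` and `J'`
with `|J'| ≤ J`. -/
theorem ginibre_duplicate [μ.IsAddHaarMeasure] [IsFiniteMeasure μ]
    (hdiv : ∀ a : K, ∃ b, b + b = a) {ι : Type*} (E : Finset ι)
    (χ : ι → K →+ Real.Angle) (hχ : ∀ i, Continuous (χ i)) (J J' : ι → ℝ)
    (hJ : ∀ i ∈ E, |J' i| ≤ J i) (f : C(K × K, ℝ))
    (hf : subAddPullback f ∈ tensorSquareCone K) :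
    0 ≤ ∫ p, f p * (Real.exp (∑ i ∈ E, J i * (χ i p.1).cos) *
      Real.exp (∑ i ∈ E, J' i * (χ i p.2).cos)) ∂(μ.prod μ) := by
  -- `J u + J' v = (J + J')/2 (u + v) + (J - J')/2 (u - v)`; the hypothesis `|J'| ≤ J` says exactly
  -- that both coefficients are non-negative.
  set H : C(K × K, ℝ) := ∑ i ∈ E,
    (((J i + J' i) / 2) •
        subAddPullback ((cosChar (χ i) (hχ i)).comp .fst + (cosChar (χ i) (hχ i)).comp .snd) +
      ((J i - J' i) / 2) •
        subAddPullback ((cosChar (χ i) (hχ i)).comp .fst - (cosChar (χ i) (hχ i)).comp .snd))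
    with hH
  have hHmem : H ∈ tensorSquareCone K := by
    refine sum_mem fun i hi => add_mem ?_ ?_
    · exact smul_mem_tensorSquareCone (by linarith [(abs_le.1 (hJ i hi)).1]) (cosChar_add_mem _ _)
    · exact smul_mem_tensorSquareCone (by linarith [(abs_le.1 (hJ i hi)).2]) (cosChar_sub_mem _ _)
  have hpos := integral_tensorSquareCone_nonneg μ (mul_mem hf (exp_mem_tensorSquareCone hHmem))
  have hmp := measurePreserving_subAddHom μ hdiv
  have hcont : Continuous fun p : K × K => f p * (Real.exp (∑ i ∈ E, J i * (χ i p.1).cos) *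
      Real.exp (∑ i ∈ E, J' i * (χ i p.2).cos)) := by
    have hc := Real.Angle.continuous_cos
    fun_prop
  rw [← hmp.map_eq, integral_map hmp.measurable.aemeasurable hcont.aestronglyMeasurable]
  refine hpos.trans_eq (integral_congr_ae (Filter.Eventually.of_forall fun p => ?_))
  simp only [ContinuousMap.mul_apply, ContinuousMap.exp_apply]
  rw [← Real.exp_add]
  refine congrArg₂ (· * ·) rfl (congrArg Real.exp ?_)
  simp only [hH, ContinuousMap.sum_apply, ← Finset.sum_add_distrib]
  refine Finset.sum_congr rfl fun i _ => ?_
  simp [subAddPullback, cosChar, subAddHom]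
  ring

/-- Comparison of `⟨cos χ₀⟩` for couplings `|J'| ≤ J`, with the normalizations cleared. -/
theorem ginibre_comparison [μ.IsAddHaarMeasure] [IsFiniteMeasure μ]
    (hdiv : ∀ a : K, ∃ b, b + b = a) {ι : Type*} (E : Finset ι)
    (χ : ι → K →+ Real.Angle) (hχ : ∀ i, Continuous (χ i)) (J J' : ι → ℝ)
    (hJ : ∀ i ∈ E, |J' i| ≤ J i) (χ₀ : K →+ Real.Angle) (hχ₀ : Continuous χ₀) :
    |∫ θ, (χ₀ θ).cos * Real.exp (∑ i ∈ E, J' i * (χ i θ).cos) ∂μ| *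
        ∫ θ, Real.exp (∑ i ∈ E, J i * (χ i θ).cos) ∂μ ≤
      (∫ θ, (χ₀ θ).cos * Real.exp (∑ i ∈ E, J i * (χ i θ).cos) ∂μ) *
        ∫ θ, Real.exp (∑ i ∈ E, J' i * (χ i θ).cos) ∂μ := by
  -- The observables `cos χ₀(θ) ± cos χ₀(θ')` give the two signs of the absolute value.
  have hp := ginibre_duplicate μ hdiv E χ hχ J J' hJ _ (cosChar_add_mem χ₀ hχ₀)
  have hm := ginibre_duplicate μ hdiv E χ hχ J J' hJ _ (cosChar_sub_mem χ₀ hχ₀)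
  have hc := Real.Angle.continuous_cos
  have hint : ∀ g : K × K → ℝ, Continuous g → Integrable g (μ.prod μ) := fun g hg =>
    hg.integrable_of_hasCompactSupport (HasCompactSupport.of_compactSpace _)
  have e1 := integral_prod_mul (μ := μ) (ν := μ)
    (fun θ => (χ₀ θ).cos * Real.exp (∑ i ∈ E, J i * (χ i θ).cos))
    (fun θ => Real.exp (∑ i ∈ E, J' i * (χ i θ).cos))
  have e2 := integral_prod_mul (μ := μ) (ν := μ)
    (fun θ => Real.exp (∑ i ∈ E, J i * (χ i θ).cos))
    (fun θ => (χ₀ θ).cos * Real.exp (∑ i ∈ E, J' i * (χ i θ).cos))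
  have i1 := hint (fun z => (χ₀ z.1).cos * Real.exp (∑ i ∈ E, J i * (χ i z.1).cos) *
    Real.exp (∑ i ∈ E, J' i * (χ i z.2).cos)) (by fun_prop)
  have i2 := hint (fun z => Real.exp (∑ i ∈ E, J i * (χ i z.1).cos) *
    ((χ₀ z.2).cos * Real.exp (∑ i ∈ E, J' i * (χ i z.2).cos))) (by fun_prop)
  have a1 := integral_add i1 i2
  have a2 := integral_sub i1 i2
  rw [e1, e2] at a1 a2
  have hp' := hp.trans_eq ((integral_congr_ae (Filter.Eventually.of_forall fun p => by
    simp [cosChar]; ring)).trans a1)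
  have hm' := hm.trans_eq ((integral_congr_ae (Filter.Eventually.of_forall fun p => by
    simp [cosChar]; ring)).trans a2)
  have hZ : 0 ≤ ∫ θ, Real.exp (∑ i ∈ E, J i * (χ i θ).cos) ∂μ :=
    integral_nonneg fun _ => (Real.exp_pos _).le
  have habs : ∀ a b : ℝ, 0 ≤ b → |a| * b = |a * b| := fun a b hb => by
    rw [abs_mul, abs_of_nonneg hb]
  rw [habs _ _ hZ, abs_le]
  constructor <;> linarith

end Ginibre

/-! ### Local rotations of the spins in a coordinate plane. -/

section Rotations

variable {N : ℕ}

/-- The rotation by the angle `t` in the plane of the coordinates `i` and `j`. -/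
noncomputable def planeRotation (i j : Fin N) (t : Real.Angle) :
    EuclideanSpace ℝ (Fin N) →ₗ[ℝ] EuclideanSpace ℝ (Fin N) where
  toFun v := v + ((t.cos - 1) * v i - t.sin * v j) • EuclideanSpace.single i (1 : ℝ) +
    (t.sin * v i + (t.cos - 1) * v j) • EuclideanSpace.single j (1 : ℝ)
  map_add' v w := by ext k; simp; split_ifs <;> ring
  map_smul' c v := by ext k; simp; split_ifs <;> ring

theorem planeRotation_apply (i j : Fin N) (t : Real.Angle) (v : EuclideanSpace ℝ (Fin N)) :
    planeRotation i j t v =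
      v + ((t.cos - 1) * v i - t.sin * v j) • EuclideanSpace.single i (1 : ℝ) +
        (t.sin * v i + (t.cos - 1) * v j) • EuclideanSpace.single j (1 : ℝ) := rfl

theorem planeRotation_fst {i j : Fin N} (hij : i ≠ j) (t : Real.Angle)
    (v : EuclideanSpace ℝ (Fin N)) :
    planeRotation i j t v i = t.cos * v i - t.sin * v j := by
  simp [planeRotation_apply, hij]; ring

theorem planeRotation_snd {i j : Fin N} (hij : i ≠ j) (t : Real.Angle)
    (v : EuclideanSpace ℝ (Fin N)) :
    planeRotation i j t v j = t.sin * v i + t.cos * v j := by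
  simp [planeRotation_apply, hij.symm]; ring

/-- Components outside the plane are fixed whatever the two angles, so only the planar part of the
scalar product changes. -/
theorem inner_planeRotation {i j : Fin N} (hij : i ≠ j) (s t : Real.Angle)
    (v w : EuclideanSpace ℝ (Fin N)) :
    inner ℝ (planeRotation i j s v) (planeRotation i j t w) =
      inner ℝ v w - (v i * w i + v j * w j) +
        (planeRotation i j s v i * planeRotation i j t w i +
          planeRotation i j s v j * planeRotation i j t w j) := by
  simp only [planeRotation_fst hij, planeRotation_snd hij]
  simp [planeRotation_apply, inner_add_left, inner_add_right, inner_smul_left, inner_smul_right,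
    EuclideanSpace.inner_single_left, EuclideanSpace.inner_single_right, hij, hij.symm]
  ring

theorem inner_planeRotation_self {i j : Fin N} (hij : i ≠ j) (t : Real.Angle)
    (v w : EuclideanSpace ℝ (Fin N)) :
    inner ℝ (planeRotation i j t v) (planeRotation i j t w) = inner ℝ v w := by
  rw [inner_planeRotation hij]
  simp only [planeRotation_fst hij, planeRotation_snd hij]
  linear_combination (v i * w i + v j * w j) * t.cos_sq_add_sin_sq

/-- The rotation in the plane of two distinct coordinates, as a linear isometry. -/
noncomputable def planeRotationIsometry {i j : Fin N} (hij : i ≠ j) (t : Real.Angle) :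
    EuclideanSpace ℝ (Fin N) ≃ₗᵢ[ℝ] EuclideanSpace ℝ (Fin N) :=
  ((planeRotation i j t).isometryOfInner (inner_planeRotation_self hij t)).toLinearIsometryEquiv
    rfl

/-- The action of a linear isometry on the unit sphere. -/
noncomputable def sphereMap (R : EuclideanSpace ℝ (Fin N) ≃ₗᵢ[ℝ] EuclideanSpace ℝ (Fin N))
    (s : SpinSphere N) : SpinSphere N :=
  ⟨R s, by simp⟩

theorem continuous_sphereMap (R : EuclideanSpace ℝ (Fin N) ≃ₗᵢ[ℝ] EuclideanSpace ℝ (Fin N)) :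
    Continuous (sphereMap R) :=
  Continuous.subtype_mk (R.continuous.comp continuous_subtype_val) _

-- The surface measure of a set is a constant times the Lebesgue volume of the truncated cone over
-- it, and an isometry maps such cones to cones of equal volume.
open scoped Pointwise in
theorem measurePreserving_sphereMap_toSphere
    (R : EuclideanSpace ℝ (Fin N) ≃ₗᵢ[ℝ] EuclideanSpace ℝ (Fin N)) :
    MeasurePreserving (sphereMap R) (volume : Measure (EuclideanSpace ℝ (Fin N))).toSphere
      (volume : Measure (EuclideanSpace ℝ (Fin N))).toSphere := by
  refine ⟨(continuous_sphereMap R).measurable, Measure.ext fun s hs => ?_⟩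
  rw [Measure.map_apply (continuous_sphereMap R).measurable hs,
    Measure.toSphere_apply' _ ((continuous_sphereMap R).measurable hs),
    Measure.toSphere_apply' _ hs,
    ← R.measurePreserving.measure_preimage_emb R.toMeasurableEquiv.measurableEmbedding
      (Set.Ioo (0 : ℝ) 1 • ((Subtype.val : SpinSphere N → _) '' s))]
  congr 2
  ext v
  simp only [Set.mem_smul, Set.mem_image, Set.mem_preimage]
  constructor
  · rintro ⟨r, hr, _, ⟨u, hu, rfl⟩, rfl⟩
    exact ⟨r, hr, _, ⟨sphereMap R u, hu, rfl⟩, by simp [sphereMap]⟩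
  · rintro ⟨r, hr, _, ⟨u, hu, rfl⟩, h⟩
    refine ⟨r, hr, _, ⟨sphereMap R.symm u, ?_, rfl⟩, R.injective ?_⟩
    · simpa [sphereMap] using hu
    · simpa [sphereMap] using h

theorem measurePreserving_sphereMap
    (R : EuclideanSpace ℝ (Fin N) ≃ₗᵢ[ℝ] EuclideanSpace ℝ (Fin N)) :
    MeasurePreserving (sphereMap R) (sphereUniform N) (sphereUniform N) :=
  (measurePreserving_sphereMap_toSphere R).smul_measure _

theorem isProbabilityMeasure_sphereUniform (hN : 2 ≤ N) :
    IsProbabilityMeasure (sphereUniform N) := by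
  have : Nonempty (Fin N) := ⟨⟨0, by omega⟩⟩
  refine ⟨?_⟩
  rw [sphereUniform, Measure.smul_apply, smul_eq_mul]
  refine ENNReal.inv_mul_cancel ?_ (measure_ne_top _ _)
  rw [Ne, Measure.measure_univ_eq_zero]
  exact Measure.toSphere_ne_zero _

variable {V : Type*}

/-- The rotation of each spin `σ x` by its own angle `φ x` in the plane of two coordinates. -/
noncomputable def rotateSpins {i j : Fin N} (hij : i ≠ j) (φ : V → Real.Angle)
    (σ : V → SpinSphere N) : V → SpinSphere N :=
  fun x => sphereMap (planeRotationIsometry hij (φ x)) (σ x)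

theorem coe_rotateSpins {i j : Fin N} (hij : i ≠ j) (φ : V → Real.Angle)
    (σ : V → SpinSphere N) (x : V) :
    (rotateSpins hij φ σ x : EuclideanSpace ℝ (Fin N)) = planeRotation i j (φ x) (σ x) := rfl

theorem continuous_rotateSpins {i j : Fin N} (hij : i ≠ j) :
    Continuous fun p : (V → Real.Angle) × (V → SpinSphere N) => rotateSpins hij p.1 p.2 := by
  have hc := Real.Angle.continuous_cos
  have hs := Real.Angle.continuous_sin
  refine continuous_pi fun x => Continuous.subtype_mk ?_ _
  change Continuous fun p : (V → Real.Angle) × (V → SpinSphere N) =>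
    planeRotation i j (p.1 x) (p.2 x)
  simp only [planeRotation_apply]
  fun_prop

variable [Fintype V]

theorem measurePreserving_rotateSpins (hN : 2 ≤ N) {i j : Fin N} (hij : i ≠ j)
    (φ : V → Real.Angle) :
    MeasurePreserving (rotateSpins hij φ) (nVectorPrior V N) (nVectorPrior V N) := by
  have := isProbabilityMeasure_sphereUniform hN
  exact measurePreserving_pi _ _ fun x => measurePreserving_sphereMap _

end Rotations

/-! ### Haar measure on the torus of angles. -/

section AngleMeasure

instance fact_two_pi_pos : Fact (0 < 2 * Real.pi) := ⟨Real.two_pi_pos⟩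

noncomputable instance : MeasureSpace Real.Angle :=
  inferInstanceAs (MeasureSpace (AddCircle (2 * Real.pi)))

instance : BorelSpace Real.Angle :=
  inferInstanceAs (BorelSpace (AddCircle (2 * Real.pi)))

instance : CompactSpace Real.Angle :=
  inferInstanceAs (CompactSpace (AddCircle (2 * Real.pi)))

instance : SecondCountableTopology Real.Angle :=
  inferInstanceAs (SecondCountableTopology (AddCircle (2 * Real.pi)))

instance : IsFiniteMeasure (volume : Measure Real.Angle) :=
  inferInstanceAs (IsFiniteMeasure (volume : Measure (AddCircle (2 * Real.pi))))

instance : (volume : Measure Real.Angle).IsAddHaarMeasure :=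
  inferInstanceAs (volume : Measure (AddCircle (2 * Real.pi))).IsAddHaarMeasure

theorem Real.Angle.measurePreserving_coe :
    MeasurePreserving ((↑) : ℝ → Real.Angle) (volume.restrict (Set.Ico 0 (2 * Real.pi)))
      volume := by
  have h := AddCircle.measurePreserving_mk (2 * Real.pi) 0
  rw [zero_add] at h
  rw [restrict_Ico_eq_restrict_Ioc]
  exact h

theorem measurePreserving_xyPrior (V : Type*) [Fintype V] :
    MeasurePreserving (fun (θ : V → ℝ) (x : V) => (θ x : Real.Angle)) (xyPrior V) volume :=
  measurePreserving_pi _ _ fun _ => Real.Angle.measurePreserving_coe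

/-- This is the 2-divisibility needed for the duplicate-variable substitution. -/
theorem Real.Angle.exists_add_self_eq {V : Type*} (a : V → Real.Angle) : ∃ b, b + b = a := by
  choose f hf using fun x => Quotient.exists_rep (a x)
  refine ⟨fun x => ((f x / 2 : ℝ) : Real.Angle), funext fun x => ?_⟩
  rw [Pi.add_apply, ← Real.Angle.coe_add, add_halves]
  exact hf x

end AngleMeasure

/-! ### Polar coordinates in a plane and unnormalized Gibbs averages. -/

section Models

/-- Orienting each edge by a chosen representative attaches to it a single character `θ_a - θ_b`, as
the Ginibre setting requires. -/
theorem Sym2.lift_eq_out {V β : Type*} (f : { f : V → V → β // ∀ a b, f a b = f b a })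
    (e : Sym2 V) : Sym2.lift f e = f.1 (Quot.out e).1 (Quot.out e).2 := by
  conv_lhs => rw [← Quot.out_eq e]
  rfl

variable {V : Type*} (G : SimpleGraph V) [Fintype G.edgeSet] {N : ℕ}

theorem nVectorHamiltonian_eq (J : Sym2 V → ℝ) (σ : V → SpinSphere N) :
    -nVectorHamiltonian G J σ =
      ∑ e ∈ G.edgeFinset, J e * spinDot (σ (Quot.out e).1) (σ (Quot.out e).2) := by
  simp only [nVectorHamiltonian, neg_neg, Sym2.lift_eq_out]

theorem continuous_nVectorHamiltonian (J : Sym2 V → ℝ) :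
    Continuous (nVectorHamiltonian G J : (V → SpinSphere N) → ℝ) := by
  have : (nVectorHamiltonian G J : (V → SpinSphere N) → ℝ) = fun σ =>
      -∑ e ∈ G.edgeFinset, J e * spinDot (σ (Quot.out e).1) (σ (Quot.out e).2) := by
    ext σ; rw [← nVectorHamiltonian_eq, neg_neg]
  rw [this]
  unfold spinDot
  fun_prop

/-- The character `θ ↦ θ_x - θ_y`. -/
noncomputable def angleDiff (x y : V) : (V → Real.Angle) →+ Real.Angle :=
  Pi.evalAddMonoidHom (fun _ : V => Real.Angle) x -
    Pi.evalAddMonoidHom (fun _ : V => Real.Angle) y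

theorem continuous_angleDiff (x y : V) : Continuous (angleDiff x y) := by
  change Continuous fun θ : V → Real.Angle => θ x - θ y
  fun_prop

/-- The planar length `√(σᵢ² + σⱼ²)` of a spin. -/
noncomputable def planeRadius (i j : Fin N) (s : SpinSphere N) : ℝ :=
  Real.sqrt (s.1 i ^ 2 + s.1 j ^ 2)

theorem planeRadius_nonneg (i j : Fin N) (s : SpinSphere N) : 0 ≤ planeRadius i j s :=
  Real.sqrt_nonneg _

theorem planeRadius_sq (i j : Fin N) (s : SpinSphere N) :
    planeRadius i j s ^ 2 = s.1 i ^ 2 + s.1 j ^ 2 :=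
  Real.sq_sqrt (by positivity)

theorem SpinSphere.sum_sq (s : SpinSphere N) : ∑ k, s.1 k ^ 2 = 1 := by
  rw [← EuclideanSpace.real_norm_sq_eq, mem_sphere_zero_iff_norm.1 s.2, one_pow]

theorem spinDot_eq_sum (s t : SpinSphere N) : spinDot s t = ∑ k, s.1 k * t.1 k := by
  simp [spinDot, PiLp.inner_apply, mul_comm]

theorem planeRadius_le_one {i j : Fin N} (hij : i ≠ j) (s : SpinSphere N) :
    planeRadius i j s ≤ 1 := by
  refine Real.sqrt_le_one.2 ?_
  refine le_of_le_of_eq ?_ (SpinSphere.sum_sq s)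
  rw [← Finset.sum_pair hij (f := fun k => s.1 k ^ 2)]
  exact Finset.sum_le_sum_of_subset_of_nonneg (Finset.subset_univ _) fun _ _ _ => sq_nonneg _

/-- `τ` is the polar angle of the projection of `s` to the plane of the coordinates `i`, `j`. -/
def IsPlaneAngle (i j : Fin N) (s : SpinSphere N) (τ : Real.Angle) : Prop :=
  s.1 i = planeRadius i j s * τ.cos ∧ s.1 j = planeRadius i j s * τ.sin

theorem exists_isPlaneAngle (i j : Fin N) (s : SpinSphere N) : ∃ τ, IsPlaneAngle i j s τ := by
  -- If the projection vanishes, `arg` takes its default value `0`; any angle would do, since the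
  -- radius is `0`.
  refine ⟨((⟨s.1 i, s.1 j⟩ : ℂ).arg : Real.Angle), ?_⟩
  have hr : planeRadius i j s = ‖(⟨s.1 i, s.1 j⟩ : ℂ)‖ := by
    rw [planeRadius, Complex.norm_eq_sqrt_sq_add_sq]
  rw [IsPlaneAngle, hr, Real.Angle.cos_coe, Real.Angle.sin_coe, Complex.norm_mul_cos_arg,
    Complex.norm_mul_sin_arg]
  exact ⟨rfl, rfl⟩

theorem planeRadius_rotateSpins {i j : Fin N} (hij : i ≠ j) (φ : V → Real.Angle)
    (σ : V → SpinSphere N) (x : V) :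
    planeRadius i j (rotateSpins hij φ σ x) = planeRadius i j (σ x) := by
  rw [planeRadius, planeRadius, coe_rotateSpins, planeRotation_fst hij, planeRotation_snd hij]
  congr 1
  linear_combination ((σ x).1 i ^ 2 + (σ x).1 j ^ 2) * (φ x).cos_sq_add_sin_sq

theorem IsPlaneAngle.rotateSpins {i j : Fin N} (hij : i ≠ j) (φ : V → Real.Angle)
    {σ : V → SpinSphere N} {x : V} {τ : Real.Angle} (h : IsPlaneAngle i j (σ x) τ) :
    IsPlaneAngle i j (rotateSpins hij φ σ x) (τ + φ x) := by
  rw [IsPlaneAngle, planeRadius_rotateSpins, coe_rotateSpins, planeRotation_fst hij,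
    planeRotation_snd hij, h.1, h.2, Real.Angle.cos_add, Real.Angle.sin_add]
  constructor <;> ring

theorem IsPlaneAngle.mul_add_mul {i j : Fin N} {s t : SpinSphere N} {τ υ : Real.Angle}
    (hs : IsPlaneAngle i j s τ) (ht : IsPlaneAngle i j t υ) :
    s.1 i * t.1 i + s.1 j * t.1 j =
      planeRadius i j s * planeRadius i j t * (τ - υ).cos := by
  rw [hs.1, hs.2, ht.1, ht.2, sub_eq_add_neg, Real.Angle.cos_add, Real.Angle.cos_neg,
    Real.Angle.sin_neg]
  ring

theorem spinDot_rotateSpins {i j : Fin N} (hij : i ≠ j) (φ : V → Real.Angle)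
    {σ : V → SpinSphere N} {τ : V → Real.Angle} (h : ∀ x, IsPlaneAngle i j (σ x) (τ x))
    (x y : V) :
    spinDot (rotateSpins hij φ σ x) (rotateSpins hij φ σ y) =
      spinDot (σ x) (σ y) - ((σ x).1 i * (σ y).1 i + (σ x).1 j * (σ y).1 j) +
        planeRadius i j (σ x) * planeRadius i j (σ y) * (angleDiff x y (τ + φ)).cos := by
  have := ((h x).rotateSpins hij φ).mul_add_mul ((h y).rotateSpins hij φ)
  rw [planeRadius_rotateSpins, planeRadius_rotateSpins] at this
  change _ = _ - _ + _ * ((τ x + φ x) - (τ y + φ y)).cos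
  rw [← this]
  exact inner_planeRotation hij _ _ _ _

theorem continuous_xyWeight (J : Sym2 V → ℝ) : Continuous fun θ : V → Real.Angle =>
    Real.exp (∑ e ∈ G.edgeFinset, J e * (angleDiff (Quot.out e).1 (Quot.out e).2 θ).cos) := by
  have hc := Real.Angle.continuous_cos
  have := fun e : Sym2 V => continuous_angleDiff (Quot.out e).1 (Quot.out e).2
  fun_prop

variable [Fintype V]

/-- The unnormalized Gibbs average of the `XY` model, over the torus of angles. -/
noncomputable def xyIntegral (J : Sym2 V → ℝ) (f : (V → Real.Angle) → ℝ) : ℝ :=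
  ∫ θ, f θ * Real.exp (∑ e ∈ G.edgeFinset,
    J e * (angleDiff (Quot.out e).1 (Quot.out e).2 θ).cos)

theorem xyIntegral_one_pos (J : Sym2 V → ℝ) : 0 < xyIntegral G J 1 := by
  simp only [xyIntegral, Pi.one_apply, one_mul]
  refine integral_exp_pos ?_
  exact (continuous_xyWeight G J).integrable_of_hasCompactSupport (HasCompactSupport.of_compactSpace _)

theorem xyExpect_eq (J : Sym2 V → ℝ) {f : (V → Real.Angle) → ℝ} (hf : Continuous f) :
    xyExpect G J (fun θ => f fun x => (θ x : Real.Angle)) =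
      xyIntegral G J f / xyIntegral G J 1 := by
  have hw : ∀ θ : V → ℝ, -xyHamiltonian G J θ = ∑ e ∈ G.edgeFinset,
      J e * (angleDiff (Quot.out e).1 (Quot.out e).2 fun x => (θ x : Real.Angle)).cos := by
    intro θ
    simp only [xyHamiltonian, neg_neg, Sym2.lift_eq_out]
    refine Finset.sum_congr rfl fun e _ => ?_
    rw [← Real.Angle.cos_coe, Real.Angle.coe_sub]
    rfl
  have ht : ∀ g : (V → Real.Angle) → ℝ, Continuous g →
      ∫ θ, g (fun x => (θ x : Real.Angle)) ∂(xyPrior V) = ∫ θ, g θ := by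
    intro g hg
    have hmp := measurePreserving_xyPrior V
    rw [← hmp.map_eq, integral_map hmp.measurable.aemeasurable hg.aestronglyMeasurable]
  rw [xyExpect, gibbsMeasure, integral_tilted]
  simp only [hw, smul_eq_mul, xyIntegral, Pi.one_apply, one_mul]
  rw [← ht _ (continuous_xyWeight G J), ← ht (fun θ => f θ * Real.exp (∑ e ∈ G.edgeFinset,
      J e * (angleDiff (Quot.out e).1 (Quot.out e).2 θ).cos)) (hf.mul (continuous_xyWeight G J)),
    ← integral_div]
  exact integral_congr_ae (Filter.Eventually.of_forall fun θ => by dsimp only; ring)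

theorem xyIntegral_nsmul_angleDiff_comparison (J J' : Sym2 V → ℝ)
    (hJ : ∀ e ∈ G.edgeFinset, |J' e| ≤ J e) (k : ℕ) (x y : V) :
    |xyIntegral G J' fun θ => (k • angleDiff x y θ).cos| * xyIntegral G J 1 ≤
      (xyIntegral G J fun θ => (k • angleDiff x y θ).cos) * xyIntegral G J' 1 := by
  have h := ginibre_comparison (volume : Measure (V → Real.Angle))
    Real.Angle.exists_add_self_eq G.edgeFinset
    (fun e => angleDiff (Quot.out e).1 (Quot.out e).2) (fun e => continuous_angleDiff _ _)
    J J' hJ (k • angleDiff x y) (by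
      change Continuous fun θ => k • angleDiff x y θ
      have := continuous_angleDiff x y
      fun_prop)
  simpa [xyIntegral] using h

/-- The unnormalized Gibbs average of the `N`-vector model. -/
noncomputable def nVectorIntegral (J : Sym2 V → ℝ) (f : (V → SpinSphere N) → ℝ) : ℝ :=
  ∫ σ, f σ * Real.exp (-nVectorHamiltonian G J σ) ∂(nVectorPrior V N)

theorem nVectorExpect_eq (J : Sym2 V → ℝ) (f : (V → SpinSphere N) → ℝ) :
    nVectorExpect G N J f = nVectorIntegral G J f / nVectorIntegral (N := N) G J 1 := by
  rw [nVectorExpect, gibbsMeasure, integral_tilted]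
  simp only [smul_eq_mul, nVectorIntegral, Pi.one_apply, one_mul, ← integral_div]
  exact integral_congr_ae (Filter.Eventually.of_forall fun σ => by dsimp only; ring)

theorem isProbabilityMeasure_nVectorPrior (hN : 2 ≤ N) :
    IsProbabilityMeasure (nVectorPrior V N) := by
  have := isProbabilityMeasure_sphereUniform hN
  unfold nVectorPrior
  infer_instance

theorem integrable_nVector (hN : 2 ≤ N) (J : Sym2 V → ℝ) {f : (V → SpinSphere N) → ℝ}
    (hf : Continuous f) :
    Integrable (fun σ => f σ * Real.exp (-nVectorHamiltonian G J σ)) (nVectorPrior V N) := by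
  have := isProbabilityMeasure_nVectorPrior (V := V) hN
  have hH := continuous_nVectorHamiltonian (N := N) G J
  exact Continuous.integrable_of_hasCompactSupport (by fun_prop)
    (HasCompactSupport.of_compactSpace _)

theorem nVectorIntegral_one_pos (hN : 2 ≤ N) (J : Sym2 V → ℝ) :
    0 < nVectorIntegral (N := N) G J 1 := by
  have := isProbabilityMeasure_nVectorPrior (V := V) hN
  have h := integrable_nVector (N := N) G hN J (continuous_one)
  simp only [nVectorIntegral, Pi.one_apply, one_mul] at h ⊢
  exact integral_exp_pos h

/-- Averaging over the local rotations of the spins in a coordinate plane. -/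
theorem integral_rotateSpins (hN : 2 ≤ N) {i j : Fin N} (hij : i ≠ j)
    {F : (V → SpinSphere N) → ℝ} (hF : Continuous F) :
    ∫ σ, ∫ φ, F (rotateSpins hij φ σ) ∂(volume : Measure (V → Real.Angle)) ∂(nVectorPrior V N) =
      (volume : Measure (V → Real.Angle)).real Set.univ * ∫ σ, F σ ∂(nVectorPrior V N) := by
  have := isProbabilityMeasure_nVectorPrior (V := V) hN
  have hcont := hF.comp (continuous_rotateSpins (V := V) hij)
  have hint : Integrable (Function.uncurry fun φ σ => F (rotateSpins hij φ σ))
      ((volume : Measure (V → Real.Angle)).prod (nVectorPrior V N)) :=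
    Continuous.integrable_of_hasCompactSupport hcont (HasCompactSupport.of_compactSpace _)
  rw [← integral_integral_swap hint]
  have hinv : ∀ φ : V → Real.Angle,
      ∫ σ, F (rotateSpins hij φ σ) ∂(nVectorPrior V N) = ∫ σ, F σ ∂(nVectorPrior V N) := by
    intro φ
    have hmp := measurePreserving_rotateSpins (V := V) hN hij φ
    conv_rhs => rw [← hmp.map_eq]
    rw [integral_map hmp.measurable.aemeasurable hF.aestronglyMeasurable]
  simp only [hinv, integral_const, smul_eq_mul]

end Models

/-! ### Conditional comparison of the rotated `N`-vector model with the `XY` model. -/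

section Comparison

variable {V : Type*} [Fintype V] (G : SimpleGraph V) [Fintype G.edgeSet] {N : ℕ}

/-- The energy outside the plane is unaffected by `φ` and becomes the factor `c`; translation
invariance of Haar measure absorbs `τ`. As `c` does not depend on `g`, it cancels between an
observable and the partition function. -/
theorem integral_rotateSpins_eq_xyIntegral (J : Sym2 V → ℝ) {i j : Fin N} (hij : i ≠ j)
    {σ : V → SpinSphere N} {τ : V → Real.Angle} (hτ : ∀ x, IsPlaneAngle i j (σ x) (τ x)) :
    ∃ c > 0, ∀ g : (V → Real.Angle) → ℝ,
      ∫ φ, g (τ + φ) * Real.exp (-nVectorHamiltonian G J (rotateSpins hij φ σ)) =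
        c * xyIntegral G (fun e => J e *
          (planeRadius i j (σ (Quot.out e).1) * planeRadius i j (σ (Quot.out e).2))) g := by
  refine ⟨Real.exp (∑ e ∈ G.edgeFinset, J e * (spinDot (σ (Quot.out e).1) (σ (Quot.out e).2) -
    ((σ (Quot.out e).1).1 i * (σ (Quot.out e).2).1 i +
      (σ (Quot.out e).1).1 j * (σ (Quot.out e).2).1 j))), Real.exp_pos _, fun g => ?_⟩
  rw [xyIntegral, ← integral_const_mul]
  refine Eq.trans ?_ (integral_add_left_eq_self (μ := (volume : Measure (V → Real.Angle))) _ τ)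
  refine integral_congr_ae (Filter.Eventually.of_forall fun φ => ?_)
  dsimp only
  rw [nVectorHamiltonian_eq, mul_left_comm, ← Real.exp_add, ← Finset.sum_add_distrib]
  refine congrArg₂ (· * ·) rfl (congrArg Real.exp (Finset.sum_congr rfl fun e _ => ?_))
  rw [spinDot_rotateSpins hij φ hτ]
  ring

theorem integrable_integral_rotateSpins (hN : 2 ≤ N) {i j : Fin N} (hij : i ≠ j)
    {F : (V → SpinSphere N) → ℝ} (hF : Continuous F) :
    Integrable (fun σ => ∫ φ, F (rotateSpins hij φ σ) ∂(volume : Measure (V → Real.Angle)))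
      (nVectorPrior V N) := by
  have hprob := isProbabilityMeasure_nVectorPrior (V := V) hN
  have hcont := hF.comp (continuous_rotateSpins (V := V) hij)
  have hint : Integrable (Function.uncurry fun φ σ => F (rotateSpins hij φ σ))
      ((volume : Measure (V → Real.Angle)).prod (nVectorPrior V N)) :=
    Continuous.integrable_of_hasCompactSupport hcont (HasCompactSupport.of_compactSpace _)
  exact hint.integral_prod_right

/-- If in polar coordinates of the `(i, j)`-plane the observable `O` is `A cos k(τ_x - τ_y)`, then
its Gibbs average is at most that of the amplitude `A` times the `XY` correlation. -/
theorem abs_nVectorIntegral_le (hN : 2 ≤ N) (J J' : Sym2 V → ℝ)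
    (hJ : ∀ e ∈ G.edgeFinset, |J' e| ≤ J e) {i j : Fin N} (hij : i ≠ j) (k : ℕ) (x y : V)
    {O A : (V → SpinSphere N) → ℝ} (hOc : Continuous O) (hAc : Continuous A)
    (hA : ∀ σ, 0 ≤ A σ) (hAr : ∀ φ σ, A (rotateSpins hij φ σ) = A σ)
    (hO : ∀ σ τ, (∀ z, IsPlaneAngle i j (σ z) (τ z)) →
      O σ = A σ * (k • angleDiff x y τ).cos) :
    |nVectorIntegral G J' O| ≤
      (xyIntegral G J (fun θ => (k • angleDiff x y θ).cos) / xyIntegral G J 1) *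
        nVectorIntegral G J' A := by
  have hprob := isProbabilityMeasure_nVectorPrior (V := V) hN
  have hZ := xyIntegral_one_pos G J
  set C := xyIntegral G J (fun θ => (k • angleDiff x y θ).cos) / xyIntegral G J 1 with hC
  have hH := continuous_nVectorHamiltonian (N := N) G J'
  -- The comparison already holds for each frozen `σ`, before integrating over `σ`.
  have key : ∀ σ : V → SpinSphere N,
      |∫ φ, O (rotateSpins hij φ σ) *
          Real.exp (-nVectorHamiltonian G J' (rotateSpins hij φ σ))| ≤
        C * ∫ φ, A (rotateSpins hij φ σ) *
          Real.exp (-nVectorHamiltonian G J' (rotateSpins hij φ σ)) := by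
    intro σ
    choose τ hτ using fun z => exists_isPlaneAngle i j (σ z)
    obtain ⟨c, hc, hg⟩ := integral_rotateSpins_eq_xyIntegral G J' hij hτ
    have hOr : ∀ φ, O (rotateSpins hij φ σ) = A σ * (k • angleDiff x y (τ + φ)).cos := by
      intro φ
      rw [← hAr φ σ]
      exact hO _ _ fun z => (hτ z).rotateSpins hij φ
    have h1 := hg 1
    simp only [Pi.one_apply, one_mul] at h1
    simp only [hOr, hAr, mul_assoc, integral_const_mul, h1,
      hg fun θ => (k • angleDiff x y θ).cos]
    -- The effective couplings are still dominated by `J`, because planar radii are at most `1`.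
    have hJr : ∀ e ∈ G.edgeFinset, |J' e * (planeRadius i j (σ (Quot.out e).1) *
        planeRadius i j (σ (Quot.out e).2))| ≤ J e := by
      intro e he
      rw [abs_mul, abs_of_nonneg (mul_nonneg (planeRadius_nonneg _ _ _)
        (planeRadius_nonneg _ _ _))]
      exact (mul_le_of_le_one_right (abs_nonneg _) (mul_le_one₀ (planeRadius_le_one hij _)
        (planeRadius_nonneg _ _ _) (planeRadius_le_one hij _))).trans (hJ e he)
    have hcmp := xyIntegral_nsmul_angleDiff_comparison G J _ hJr k x y
    rw [abs_mul, abs_mul, abs_of_nonneg (hA σ), abs_of_pos hc, mul_left_comm C (A σ),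
      mul_left_comm C c]
    refine mul_le_mul_of_nonneg_left (mul_le_mul_of_nonneg_left ?_ hc.le) (hA σ)
    rw [hC, div_mul_eq_mul_div, le_div_iff₀ hZ]
    exact hcmp
  have hv : 0 < (volume : Measure (V → Real.Angle)).real Set.univ :=
    ENNReal.toReal_pos (isOpen_univ.measure_ne_zero _ Set.univ_nonempty) (measure_ne_top _ _)
  have hcont : ∀ {F : (V → SpinSphere N) → ℝ}, Continuous F →
      Continuous fun σ => F σ * Real.exp (-nVectorHamiltonian G J' σ) := fun hF => by fun_prop
  have hint := fun {F : (V → SpinSphere N) → ℝ} (hF : Continuous F) =>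
    integrable_integral_rotateSpins (V := V) hN hij hF
  -- Multiplying by the volume of the torus turns both sides into averages over local rotations.
  refine le_of_mul_le_mul_left ?_ hv
  rw [← abs_of_pos hv, ← abs_mul, abs_of_pos hv, mul_left_comm, nVectorIntegral, nVectorIntegral,
    ← integral_rotateSpins hN hij (hcont hOc), ← integral_rotateSpins hN hij (hcont hAc),
    ← integral_const_mul]
  refine (abs_integral_le_integral_abs).trans
    (integral_mono (hint (hcont hOc)).abs ((hint (hcont hAc)).const_mul C) key)

end Comparison

/-! ### Sums of planar polynomials over all coordinate planes. -/

section Moments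

variable {N : ℕ}

theorem Finset.sum_univ_offDiag {ι : Type*} [Fintype ι] [DecidableEq ι] (f : ι → ι → ℝ) :
    ∑ p ∈ (Finset.univ : Finset ι).offDiag, f p.1 p.2 = ∑ i, ∑ j, f i j - ∑ i, f i i := by
  rw [eq_sub_iff_add_eq', ← Finset.sum_diag Finset.univ (fun p : ι × ι => f p.1 p.2),
    ← Finset.sum_union (Finset.disjoint_diag_offDiag _), Finset.diag_union_offDiag,
    Finset.sum_product]

/-- The polynomial `Re (uₓ² ūᵧ²)` in the planar projections `u` of two spins. -/
def planarQuartic (i j : Fin N) (s t : SpinSphere N) : ℝ :=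
  (s.1 i ^ 2 - s.1 j ^ 2) * (t.1 i ^ 2 - t.1 j ^ 2) + 4 * (s.1 i * s.1 j * t.1 i * t.1 j)

/-- The sum of the products of the squares of the components of two spins. -/
def squareOverlap (s t : SpinSphere N) : ℝ := ∑ i, s.1 i ^ 2 * t.1 i ^ 2

/-- Planes are counted as ordered pairs of distinct coordinates, so each coordinate occurs `2 (N -
1)` times. -/
theorem sum_offDiag_planarDot (s t : SpinSphere N) :
    ∑ p ∈ (Finset.univ : Finset (Fin N)).offDiag, (s.1 p.1 * t.1 p.1 + s.1 p.2 * t.1 p.2) =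
      2 * ((N : ℝ) - 1) * spinDot s t := by
  rw [Finset.sum_univ_offDiag fun i j => s.1 i * t.1 i + s.1 j * t.1 j]
  simp only [Finset.sum_add_distrib, Finset.sum_const, Finset.card_univ, Fintype.card_fin,
    nsmul_eq_mul, ← Finset.mul_sum, ← spinDot_eq_sum]
  ring

theorem sum_offDiag_planeRadius_sq (s : SpinSphere N) :
    ∑ p ∈ (Finset.univ : Finset (Fin N)).offDiag, planeRadius p.1 p.2 s ^ 2 =
      2 * ((N : ℝ) - 1) := by
  rw [Finset.sum_univ_offDiag fun i j => planeRadius i j s ^ 2]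
  simp only [planeRadius_sq, Finset.sum_add_distrib, Finset.sum_const, Finset.card_univ,
    Fintype.card_fin, nsmul_eq_mul, ← Finset.mul_sum, SpinSphere.sum_sq]
  ring

theorem sum_sum_sq_mul_sq (s t : SpinSphere N) : ∑ i, ∑ j, s.1 i ^ 2 * t.1 j ^ 2 = 1 := by
  simp only [← Finset.mul_sum, SpinSphere.sum_sq, mul_one]

theorem sum_sum_mul_mul_mul (s t : SpinSphere N) :
    ∑ i, ∑ j, s.1 i * s.1 j * t.1 i * t.1 j = spinDot s t ^ 2 := by
  rw [spinDot_eq_sum, sq, Finset.sum_mul_sum]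
  exact Finset.sum_congr rfl fun i _ => Finset.sum_congr rfl fun j _ => by ring

theorem sum_sum_sq_mul_sq_fst (s t : SpinSphere N) :
    ∑ i, ∑ _j : Fin N, s.1 i ^ 2 * t.1 i ^ 2 = N * squareOverlap s t := by
  simp [squareOverlap, Finset.mul_sum]

theorem sum_sum_sq_mul_sq_snd (s t : SpinSphere N) :
    ∑ _i : Fin N, ∑ j, s.1 j ^ 2 * t.1 j ^ 2 = N * squareOverlap s t := by
  simp [squareOverlap]

theorem sum_offDiag_planarQuartic (s t : SpinSphere N) :
    ∑ p ∈ (Finset.univ : Finset (Fin N)).offDiag, planarQuartic p.1 p.2 s t =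
      (2 * (N : ℝ) - 4) * squareOverlap s t - 2 + 4 * spinDot s t ^ 2 := by
  have h : ∀ i j, planarQuartic i j s t = s.1 i ^ 2 * t.1 i ^ 2 + s.1 j ^ 2 * t.1 j ^ 2 -
      s.1 i ^ 2 * t.1 j ^ 2 - t.1 i ^ 2 * s.1 j ^ 2 + 4 * (s.1 i * s.1 j * t.1 i * t.1 j) :=
    fun i j => by rw [planarQuartic]; ring
  have hd : ∀ i, planarQuartic i i s t = 4 * (s.1 i ^ 2 * t.1 i ^ 2) :=
    fun i => by rw [planarQuartic]; ring
  rw [Finset.sum_univ_offDiag fun i j => planarQuartic i j s t]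
  simp only [hd]
  simp only [h, Finset.sum_add_distrib, Finset.sum_sub_distrib, sum_sum_sq_mul_sq_fst,
    sum_sum_sq_mul_sq_snd, sum_sum_sq_mul_sq]
  simp only [← Finset.mul_sum, sum_sum_mul_mul_mul]
  rw [← squareOverlap]
  ring

theorem sum_offDiag_planeRadius_sq_mul (s t : SpinSphere N) :
    ∑ p ∈ (Finset.univ : Finset (Fin N)).offDiag,
        planeRadius p.1 p.2 s ^ 2 * planeRadius p.1 p.2 t ^ 2 =
      (2 * (N : ℝ) - 4) * squareOverlap s t + 2 := by
  have h : ∀ i j, planeRadius i j s ^ 2 * planeRadius i j t ^ 2 =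
      s.1 i ^ 2 * t.1 i ^ 2 + s.1 j ^ 2 * t.1 j ^ 2 +
        s.1 i ^ 2 * t.1 j ^ 2 + t.1 i ^ 2 * s.1 j ^ 2 :=
    fun i j => by rw [planeRadius_sq, planeRadius_sq]; ring
  have hd : ∀ i, planeRadius i i s ^ 2 * planeRadius i i t ^ 2 = 4 * (s.1 i ^ 2 * t.1 i ^ 2) :=
    fun i => by rw [h]; ring
  rw [Finset.sum_univ_offDiag fun i j => planeRadius i j s ^ 2 * planeRadius i j t ^ 2]
  simp only [hd]
  simp only [h, Finset.sum_add_distrib, sum_sum_sq_mul_sq_fst,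
    sum_sum_sq_mul_sq_snd, sum_sum_sq_mul_sq]
  simp only [← Finset.mul_sum]
  rw [← squareOverlap]
  ring

/-- The combination of fourth moments that vanishes for an `O(N)`-invariant law. -/
def rotationDefect (i j : Fin N) (s t : SpinSphere N) : ℝ :=
  s.1 i ^ 2 * t.1 i ^ 2 + s.1 j ^ 2 * t.1 j ^ 2 - s.1 i ^ 2 * t.1 j ^ 2 -
    t.1 i ^ 2 * s.1 j ^ 2 - 4 * (s.1 i * s.1 j * t.1 i * t.1 j)

theorem sum_offDiag_rotationDefect (s t : SpinSphere N) :
    ∑ p ∈ (Finset.univ : Finset (Fin N)).offDiag, rotationDefect p.1 p.2 s t =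
      2 * (((N : ℝ) + 2) * squareOverlap s t - (1 + 2 * spinDot s t ^ 2)) := by
  have hd : ∀ i, rotationDefect i i s t = -4 * (s.1 i ^ 2 * t.1 i ^ 2) :=
    fun i => by rw [rotationDefect]; ring
  rw [Finset.sum_univ_offDiag fun i j => rotationDefect i j s t]
  simp only [hd]
  simp only [rotationDefect, Finset.sum_sub_distrib, Finset.sum_add_distrib,
    sum_sum_sq_mul_sq_fst, sum_sum_sq_mul_sq_snd, sum_sum_sq_mul_sq]
  simp only [← Finset.mul_sum, sum_sum_mul_mul_mul]
  rw [← squareOverlap]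
  ring

end Moments

/-! ### Normalized expectations and the two correlation bounds. -/

section Expectations

theorem continuous_planeRadius_apply {V : Type*} {N : ℕ} (i j : Fin N) (x : V) :
    Continuous fun σ : V → SpinSphere N => planeRadius i j (σ x) := by
  unfold planeRadius; fun_prop

variable {V : Type*} [Fintype V] (G : SimpleGraph V) [Fintype G.edgeSet] {N : ℕ}

theorem isProbabilityMeasure_nVectorGibbs (hN : 2 ≤ N) (J : Sym2 V → ℝ) :
    IsProbabilityMeasure (gibbsMeasure (nVectorPrior V N) (nVectorHamiltonian G J)) := by
  have := isProbabilityMeasure_nVectorPrior (V := V) hN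
  have h := integrable_nVector (N := N) G hN J continuous_one
  simp only [Pi.one_apply, one_mul] at h
  exact isProbabilityMeasure_tilted h

theorem integrable_nVectorGibbs (hN : 2 ≤ N) (J : Sym2 V → ℝ) {f : (V → SpinSphere N) → ℝ}
    (hf : Continuous f) :
    Integrable f (gibbsMeasure (nVectorPrior V N) (nVectorHamiltonian G J)) := by
  have := isProbabilityMeasure_nVectorGibbs (N := N) G hN J
  exact hf.integrable_of_hasCompactSupport (HasCompactSupport.of_compactSpace _)

theorem nVectorExpect_add (hN : 2 ≤ N) (J : Sym2 V → ℝ) {f g : (V → SpinSphere N) → ℝ}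
    (hf : Continuous f) (hg : Continuous g) :
    nVectorExpect G N J (fun σ => f σ + g σ) = nVectorExpect G N J f + nVectorExpect G N J g :=
  integral_add (integrable_nVectorGibbs G hN J hf) (integrable_nVectorGibbs G hN J hg)

theorem nVectorExpect_sum (hN : 2 ≤ N) (J : Sym2 V → ℝ) {ι : Type*} (s : Finset ι)
    {f : ι → (V → SpinSphere N) → ℝ} (hf : ∀ i ∈ s, Continuous (f i)) :
    nVectorExpect G N J (fun σ => ∑ i ∈ s, f i σ) = ∑ i ∈ s, nVectorExpect G N J (f i) :=
  integral_finsetSum _ fun i hi => integrable_nVectorGibbs G hN J (hf i hi)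

theorem nVectorExpect_const_mul (J : Sym2 V → ℝ) (c : ℝ) (f : (V → SpinSphere N) → ℝ) :
    nVectorExpect G N J (fun σ => c * f σ) = c * nVectorExpect G N J f :=
  integral_const_mul _ _

theorem nVectorExpect_const (hN : 2 ≤ N) (J : Sym2 V → ℝ) (c : ℝ) :
    nVectorExpect G N J (fun _ => c) = c := by
  have := isProbabilityMeasure_nVectorGibbs (N := N) G hN J
  simp [nVectorExpect]

theorem nVectorExpect_mono (hN : 2 ≤ N) (J : Sym2 V → ℝ) {f g : (V → SpinSphere N) → ℝ}
    (hf : Continuous f) (hg : Continuous g) (h : ∀ σ, f σ ≤ g σ) :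
    nVectorExpect G N J f ≤ nVectorExpect G N J g :=
  integral_mono (integrable_nVectorGibbs G hN J hf) (integrable_nVectorGibbs G hN J hg) h

/-- Invariance of the `N`-vector model under a global rotation in a coordinate plane. -/
theorem nVectorExpect_rotateSpins (hN : 2 ≤ N) (J : Sym2 V → ℝ) {i j : Fin N} (hij : i ≠ j)
    (t : Real.Angle) {f : (V → SpinSphere N) → ℝ} (hf : Continuous f) :
    nVectorExpect G N J (fun σ => f (rotateSpins hij (fun _ => t) σ)) = nVectorExpect G N J f := by
  have hH := continuous_nVectorHamiltonian (N := N) G J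
  have hinv : ∀ σ : V → SpinSphere N,
      -nVectorHamiltonian G J (rotateSpins hij (fun _ => t) σ) = -nVectorHamiltonian G J σ := by
    intro σ
    rw [nVectorHamiltonian_eq, nVectorHamiltonian_eq]
    exact Finset.sum_congr rfl fun e _ => congrArg _ (inner_planeRotation_self hij t _ _)
  have hmp := measurePreserving_rotateSpins (V := V) hN hij fun _ => t
  rw [nVectorExpect_eq, nVectorExpect_eq]
  refine congrArg (· / _) ?_
  simp only [nVectorIntegral]
  conv_rhs => rw [← hmp.map_eq]
  rw [integral_map hmp.measurable.aemeasurable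
    (Continuous.aestronglyMeasurable (by fun_prop))]
  simp only [hinv]

/-- In polar coordinates the defect is `r_x² r_y² cos 2(τ_x + τ_y)`. A global rotation by `π/4` adds
`π` to the argument of the cosine and so reverses the sign. -/
theorem nVectorExpect_rotationDefect (hN : 2 ≤ N) (J : Sym2 V → ℝ) {i j : Fin N} (hij : i ≠ j)
    (x y : V) : nVectorExpect G N J (fun σ => rotationDefect i j (σ x) (σ y)) = 0 := by
  have hc : Continuous fun σ : V → SpinSphere N => rotationDefect i j (σ x) (σ y) := by
    unfold rotationDefect; fun_prop
  have h := nVectorExpect_rotateSpins G hN J hij ((Real.pi / 4 : ℝ) : Real.Angle) hc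
  have hneg : ∀ σ : V → SpinSphere N,
      rotationDefect i j (rotateSpins hij (fun _ => ((Real.pi / 4 : ℝ) : Real.Angle)) σ x)
        (rotateSpins hij (fun _ => ((Real.pi / 4 : ℝ) : Real.Angle)) σ y) =
      -1 * rotationDefect i j (σ x) (σ y) := by
    intro σ
    have h2 : Real.sqrt 2 ^ 2 = 2 := Real.sq_sqrt (by norm_num)
    have h4 : Real.sqrt 2 ^ 4 = 4 := by rw [show (4 : ℕ) = 2 * 2 from rfl, pow_mul, h2]; norm_num
    simp only [rotationDefect, coe_rotateSpins, planeRotation_fst hij, planeRotation_snd hij,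
      Real.Angle.cos_coe, Real.Angle.sin_coe, Real.cos_pi_div_four, Real.sin_pi_div_four]
    ring_nf
    rw [h4]
    ring
  simp only [hneg, nVectorExpect_const_mul] at h
  linarith

theorem xyExpect_cos_eq (J : Sym2 V → ℝ) (k : ℕ) (x y : V) :
    xyExpect G J (fun θ => Real.cos (k * (θ x - θ y))) =
      xyIntegral G J (fun θ => (k • angleDiff x y θ).cos) / xyIntegral G J 1 := by
  have hc := Real.Angle.continuous_cos
  have hd := continuous_angleDiff x y
  rw [← xyExpect_eq G J (f := fun θ => (k • angleDiff x y θ).cos) (by fun_prop)]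
  congr 1
  ext θ
  rw [← Real.Angle.cos_coe, ← nsmul_eq_mul, Real.Angle.coe_nsmul, Real.Angle.coe_sub]
  rfl

/-- Comparing the model with itself bounds the absolute value of the correlation by the correlation.
-/
theorem xyExpect_cos_nonneg (J : Sym2 V → ℝ) (hJ : ∀ e ∈ G.edgeFinset, 0 ≤ J e) (k : ℕ)
    (x y : V) : 0 ≤ xyExpect G J (fun θ => Real.cos (k * (θ x - θ y))) := by
  have hZ := xyIntegral_one_pos G J
  have h := xyIntegral_nsmul_angleDiff_comparison G J J
    (fun e he => (abs_of_nonneg (hJ e he)).le) k x y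
  rw [xyExpect_cos_eq]
  exact div_nonneg ((abs_nonneg _).trans (le_of_mul_le_mul_right h hZ)) hZ.le

theorem xyExpect_cos_le_one (J : Sym2 V → ℝ) (k : ℕ) (x y : V) :
    xyExpect G J (fun θ => Real.cos (k * (θ x - θ y))) ≤ 1 := by
  have hc := Real.Angle.continuous_cos
  have hd := continuous_angleDiff x y
  have hw := continuous_xyWeight G J
  rw [xyExpect_cos_eq, div_le_one (xyIntegral_one_pos G J)]
  refine integral_mono ?_ ?_ fun θ => ?_
  · exact Continuous.integrable_of_hasCompactSupport (by fun_prop)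
      (HasCompactSupport.of_compactSpace _)
  · exact Continuous.integrable_of_hasCompactSupport (by fun_prop)
      (HasCompactSupport.of_compactSpace _)
  · refine mul_le_mul_of_nonneg_right ?_ (Real.exp_pos _).le
    change (k • angleDiff x y θ).cos ≤ 1
    induction k • angleDiff x y θ using Real.Angle.induction_on with
    | _ a => rw [Real.Angle.cos_coe]; exact Real.cos_le_one a

variable (J J' : Sym2 V → ℝ)

theorem abs_nVectorExpect_le (hN : 2 ≤ N) (hJ : ∀ e ∈ G.edgeFinset, |J' e| ≤ J e)
    {i j : Fin N} (hij : i ≠ j) (k : ℕ) (x y : V) {O : (V → SpinSphere N) → ℝ}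
    (hOc : Continuous O)
    (hO : ∀ σ τ, (∀ z, IsPlaneAngle i j (σ z) (τ z)) →
      O σ = planeRadius i j (σ x) ^ k * planeRadius i j (σ y) ^ k *
        (k • angleDiff x y τ).cos) :
    |nVectorExpect G N J' O| ≤ xyExpect G J (fun θ => Real.cos (k * (θ x - θ y))) *
      nVectorExpect G N J'
        (fun σ => planeRadius i j (σ x) ^ k * planeRadius i j (σ y) ^ k) := by
  have hr := continuous_planeRadius_apply (V := V) i j
  have h := abs_nVectorIntegral_le G hN J J' hJ hij k x y hOc
    (A := fun σ => planeRadius i j (σ x) ^ k * planeRadius i j (σ y) ^ k)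
    (((hr x).pow k).mul ((hr y).pow k))
    (fun σ => mul_nonneg (pow_nonneg (planeRadius_nonneg _ _ _) _)
      (pow_nonneg (planeRadius_nonneg _ _ _) _))
    (fun φ σ => by simp only [planeRadius_rotateSpins]) hO
  have hZ := nVectorIntegral_one_pos (N := N) G hN J'
  rw [nVectorExpect_eq, nVectorExpect_eq, xyExpect_cos_eq, abs_div, abs_of_pos hZ, ← mul_div_assoc]
  exact div_le_div_of_nonneg_right h hZ.le

theorem abs_nVectorExpect_spinDot_le (hN : 2 ≤ N) (hJ : ∀ e ∈ G.edgeFinset, |J' e| ≤ J e)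
    (x y : V) :
    |nVectorExpect G N J' (fun σ => spinDot (σ x) (σ y))| ≤
      xyExpect G J (fun θ => Real.cos (θ x - θ y)) := by
  have hr := fun p : Fin N × Fin N => continuous_planeRadius_apply (V := V) p.1 p.2
  set c := xyExpect G J (fun θ => Real.cos (θ x - θ y)) with hc
  have hc1 : xyExpect G J (fun θ => Real.cos ((1 : ℕ) * (θ x - θ y))) = c := by
    simp only [Nat.cast_one, one_mul, hc]
  have hc0 : 0 ≤ c := by
    rw [← hc1]
    exact xyExpect_cos_nonneg G J (fun e he => (abs_nonneg _).trans (hJ e he)) 1 x y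
  have hN1 : (0 : ℝ) < 2 * ((N : ℝ) - 1) := by
    have : (2 : ℝ) ≤ N := by exact_mod_cast hN
    linarith
  have hpair : ∀ p ∈ (Finset.univ : Finset (Fin N)).offDiag,
      |nVectorExpect G N J' (fun σ => (σ x).1 p.1 * (σ y).1 p.1 + (σ x).1 p.2 * (σ y).1 p.2)| ≤
        c * nVectorExpect G N J' (fun σ => 1 / 2 * planeRadius p.1 p.2 (σ x) ^ 2 +
          1 / 2 * planeRadius p.1 p.2 (σ y) ^ 2) := by
    intro p hp
    have h := abs_nVectorExpect_le G J J' hN hJ (Finset.mem_offDiag.1 hp).2.2 1 x y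
      (O := fun σ => (σ x).1 p.1 * (σ y).1 p.1 + (σ x).1 p.2 * (σ y).1 p.2) (by fun_prop)
      (fun σ τ hτ => by
        rw [(hτ x).mul_add_mul (hτ y), pow_one, pow_one, one_nsmul]; rfl)
    rw [hc1] at h
    refine h.trans (mul_le_mul_of_nonneg_left (nVectorExpect_mono G hN J' ?_ ?_ fun σ => ?_) hc0)
    · exact ((hr p x).pow 1).mul ((hr p y).pow 1)
    · exact (((hr p x).pow 2).const_mul _).add (((hr p y).pow 2).const_mul _)
    -- `r_x r_y ≤ (r_x² + r_y²) / 2`; the right side, unlike the left, has a constant sum over the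
    -- planes.
    · nlinarith [sq_nonneg (planeRadius p.1 p.2 (σ x) - planeRadius p.1 p.2 (σ y))]
  have hsum := (Finset.abs_sum_le_sum_abs _ _).trans (Finset.sum_le_sum hpair)
  rw [← Finset.mul_sum, ← nVectorExpect_sum G hN J' _ (fun p _ => by fun_prop),
    ← nVectorExpect_sum G hN J' _ (fun p _ => by
      have := hr p
      fun_prop)] at hsum
  simp only [sum_offDiag_planarDot, nVectorExpect_const_mul] at hsum
  simp only [Finset.sum_add_distrib, ← Finset.mul_sum, sum_offDiag_planeRadius_sq,
    nVectorExpect_const G hN] at hsum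
  rw [abs_mul, abs_of_pos hN1] at hsum
  refine le_of_mul_le_mul_left (hsum.trans_eq ?_) hN1
  ring

/-- The defect has mean zero in every plane; summing over planes expresses the basis-dependent
moment through the invariant one. -/
theorem nVectorExpect_squareOverlap (hN : 2 ≤ N) (x y : V) :
    ((N : ℝ) + 2) * nVectorExpect G N J' (fun σ => squareOverlap (σ x) (σ y)) =
      1 + 2 * nVectorExpect G N J' (fun σ => spinDot (σ x) (σ y) ^ 2) := by
  have h := nVectorExpect_sum G hN J' (Finset.univ : Finset (Fin N)).offDiag
    (f := fun p σ => rotationDefect p.1 p.2 (σ x) (σ y))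
    (fun p _ => by unfold rotationDefect; fun_prop)
  rw [Finset.sum_eq_zero fun p hp =>
    nVectorExpect_rotationDefect G hN J' (Finset.mem_offDiag.1 hp).2.2 x y] at h
  have he : ∀ σ : V → SpinSphere N,
      ∑ p ∈ (Finset.univ : Finset (Fin N)).offDiag, rotationDefect p.1 p.2 (σ x) (σ y) =
        (2 * ((N : ℝ) + 2)) * squareOverlap (σ x) (σ y) +
          ((-4) * spinDot (σ x) (σ y) ^ 2 + (-2)) := fun σ => by
    rw [sum_offDiag_rotationDefect]; ring
  have hc1 : Continuous fun σ : V → SpinSphere N => squareOverlap (σ x) (σ y) := by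
    unfold squareOverlap; fun_prop
  have hc2 : Continuous fun σ : V → SpinSphere N => spinDot (σ x) (σ y) ^ 2 := by
    unfold spinDot; fun_prop
  simp only [he] at h
  rw [nVectorExpect_add G hN J' (by fun_prop) (by fun_prop),
    nVectorExpect_add G hN J' (by fun_prop) (by fun_prop), nVectorExpect_const_mul,
    nVectorExpect_const_mul, nVectorExpect_const G hN] at h
  linarith

/-- This is the case `k = 2` summed over the planes. The amplitudes `r_x² r_y²` are kept exactly,
since their sum involves only `squareOverlap`. -/
theorem nVectorExpect_planarQuartic_le (hN : 2 ≤ N) (hJ : ∀ e ∈ G.edgeFinset, |J' e| ≤ J e)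
    (x y : V) :
    (2 * (N : ℝ) - 4) * nVectorExpect G N J' (fun σ => squareOverlap (σ x) (σ y)) - 2 +
        4 * nVectorExpect G N J' (fun σ => spinDot (σ x) (σ y) ^ 2) ≤
      xyExpect G J (fun θ => Real.cos (2 * (θ x - θ y))) *
        ((2 * (N : ℝ) - 4) * nVectorExpect G N J' (fun σ => squareOverlap (σ x) (σ y)) + 2) := by
  have hr := fun p : Fin N × Fin N => continuous_planeRadius_apply (V := V) p.1 p.2
  have hcq : ∀ p : Fin N × Fin N,
      Continuous fun σ : V → SpinSphere N => planarQuartic p.1 p.2 (σ x) (σ y) := fun p => by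
    unfold planarQuartic; fun_prop
  have hpair : ∀ p ∈ (Finset.univ : Finset (Fin N)).offDiag,
      nVectorExpect G N J' (fun σ => planarQuartic p.1 p.2 (σ x) (σ y)) ≤
        xyExpect G J (fun θ => Real.cos ((2 : ℕ) * (θ x - θ y))) * nVectorExpect G N J'
          (fun σ => planeRadius p.1 p.2 (σ x) ^ 2 * planeRadius p.1 p.2 (σ y) ^ 2) := by
    intro p hp
    refine (le_abs_self _).trans (abs_nVectorExpect_le G J J' hN hJ
      (Finset.mem_offDiag.1 hp).2.2 2 x y (hcq p) fun σ τ hτ => ?_)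
    have hd : (2 • angleDiff x y τ).cos = 2 * (τ x - τ y).cos ^ 2 - 1 := by
      change (2 • (τ x - τ y)).cos = _
      rw [two_nsmul, Real.Angle.cos_add]
      linear_combination -(τ x - τ y).cos_sq_add_sin_sq
    have hm := (hτ x).mul_add_mul (hτ y)
    rw [hd, planarQuartic]
    have hx := planeRadius_sq p.1 p.2 (σ x)
    have hy := planeRadius_sq p.1 p.2 (σ y)
    calc _ = 2 * ((σ x).1 p.1 * (σ y).1 p.1 + (σ x).1 p.2 * (σ y).1 p.2) ^ 2 -
          ((σ x).1 p.1 ^ 2 + (σ x).1 p.2 ^ 2) * ((σ y).1 p.1 ^ 2 + (σ y).1 p.2 ^ 2) := by ring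
      _ = _ := by rw [hm, ← hx, ← hy]; ring
  have hsum := Finset.sum_le_sum hpair
  rw [← Finset.mul_sum, ← nVectorExpect_sum G hN J' _ (fun p _ => hcq p),
    ← nVectorExpect_sum G hN J' _ (fun p _ => by
      have := hr p
      fun_prop)] at hsum
  have hc1 : Continuous fun σ : V → SpinSphere N => squareOverlap (σ x) (σ y) := by
    unfold squareOverlap; fun_prop
  have hc2 : Continuous fun σ : V → SpinSphere N => spinDot (σ x) (σ y) ^ 2 := by
    unfold spinDot; fun_prop
  simp only [sum_offDiag_planarQuartic, sum_offDiag_planeRadius_sq_mul, Nat.cast_ofNat,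
    sub_eq_add_neg (_ * _) (2 : ℝ)] at hsum
  rw [nVectorExpect_add G hN J' (by fun_prop) (by fun_prop),
    nVectorExpect_add G hN J' (by fun_prop) (by fun_prop),
    nVectorExpect_add G hN J' (by fun_prop) (by fun_prop), nVectorExpect_const_mul,
    nVectorExpect_const_mul, nVectorExpect_const G hN, nVectorExpect_const G hN] at hsum
  exact hsum

end Expectations

theorem theoremC7 {V : Type*} [Fintype V] (G : SimpleGraph V) [Fintype G.edgeSet]
    (N : ℕ) (hN : 2 ≤ N) (J J' : Sym2 V → ℝ) (hJ : ∀ e ∈ G.edgeSet, |J' e| ≤ J e) (x y : V) :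
    |nVectorExpect G N J' (fun σ => spinDot (σ x) (σ y))|
        ≤ xyExpect G J (fun θ => Real.cos (θ x - θ y)) ∧
    0 ≤ nVectorExpect G N J' (fun σ => spinDot (σ x) (σ y) ^ 2) ∧
    nVectorExpect G N J' (fun σ => spinDot (σ x) (σ y) ^ 2)
        ≤ 1 / (N : ℝ) +
          (((N : ℝ) - 1) * ((N : ℝ) + 2)) /
              ((N : ℝ) * (2 * (N : ℝ) -
                ((N : ℝ) - 2) * xyExpect G J (fun θ => Real.cos (2 * (θ x - θ y))))) *
            xyExpect G J (fun θ => Real.cos (2 * (θ x - θ y))) ∧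
    1 / (N : ℝ) +
          (((N : ℝ) - 1) * ((N : ℝ) + 2)) /
              ((N : ℝ) * (2 * (N : ℝ) -
                ((N : ℝ) - 2) * xyExpect G J (fun θ => Real.cos (2 * (θ x - θ y))))) *
            xyExpect G J (fun θ => Real.cos (2 * (θ x - θ y)))
        ≤ 1 / (N : ℝ) +
          (1 - 1 / (N : ℝ)) * xyExpect G J (fun θ => Real.cos (2 * (θ x - θ y))) := by
  have hJ' : ∀ e ∈ G.edgeFinset, |J' e| ≤ J e := fun e he =>
    hJ e (SimpleGraph.mem_edgeFinset.1 he)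
  have hγ0 := xyExpect_cos_nonneg G J (fun e he => (abs_nonneg _).trans (hJ' e he)) 2 x y
  have hγ1 := xyExpect_cos_le_one G J 2 x y
  have hD := nVectorExpect_squareOverlap G J' hN x y
  have hQ := nVectorExpect_planarQuartic_le G J J' hN hJ' x y
  rw [Nat.cast_ofNat] at hγ0 hγ1
  refine ⟨abs_nVectorExpect_spinDot_le G J J' hN hJ' x y,
    integral_nonneg fun σ => sq_nonneg _, ?_, ?_⟩
  all_goals
    generalize xyExpect G J (fun θ => Real.cos (2 * (θ x - θ y))) = γ at *
    generalize nVectorExpect G N J' (fun σ => squareOverlap (σ x) (σ y)) = D at *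
    generalize nVectorExpect G N J' (fun σ => spinDot (σ x) (σ y) ^ 2) = Q at *
    have hN2 : (2 : ℝ) ≤ N := by exact_mod_cast hN
    generalize (N : ℝ) = n at *
    have hn : 0 < n := by linarith
    -- From `γ ≤ 1` and `n ≥ 2`; this gives positivity of the denominator and also the last, weaker
    -- bound.
    have hM : n + 2 ≤ 2 * n - (n - 2) * γ := by nlinarith
    have hM0 : 0 < 2 * n - (n - 2) * γ := by linarith
  -- Eliminating `D` from `hQ` gives `8nQ - 8 ≤ γ (4n + (4n - 8) Q)`, which is four times this
  -- inequality after rearranging.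
  · have hkey : Q * (2 * n - (n - 2) * γ) ≤ 2 + γ * n := by
      obtain rfl : D = (1 + 2 * Q) / (n + 2) := by
        rw [eq_div_iff (by linarith)]; linarith
      field_simp at hQ
      linarith
    calc Q ≤ (2 + γ * n) / (2 * n - (n - 2) * γ) := (le_div_iff₀ hM0).2 hkey
      _ = _ := by
        generalize hM' : 2 * n - (n - 2) * γ = M at *
        field_simp
        linear_combination hM'
  · have h : (n - 1) * (n + 2) / (n * (2 * n - (n - 2) * γ)) ≤ 1 - 1 / n := by
      rw [div_le_iff₀ (by positivity)]
      calc (n - 1) * (n + 2) ≤ (n - 1) * (2 * n - (n - 2) * γ) :=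
            mul_le_mul_of_nonneg_left hM (by linarith)
        _ = _ := by field_simp
    exact add_le_add_right (mul_le_mul_of_nonneg_right h hγ0) _
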